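/- Let $N\ge 4$ and $n\ge 1$ be integers with $\gcd(N-1,n)<\frac{N-1}{2}$, and put $\kappa=-\frac{n}{N-1}$. For polynomials $f$ in $x_1,\dots,x_N$ over a field of characteristic zero, let $(i,j)f$ denote the polynomial obtained from $f$ by interchanging $x_i$ and $x_j$, and define the Dunkl operators \[ \mathcal D_i f=\frac{\partial f}{\partial x_i}+\kappa\sum_{j\ne i}\frac{f-(i,j)f}{x_i-x_j}\qquad(1\le i\le N). \] Define polynomials $p_{m\ell}$ ($m,\ell\ge 0$) by the generating function \[ \sum_{m,\ell\ge 0}p_{m\ell}(x)\,s^m t^\ell=(1-sx_1)^{-1}(1-tx_2)^{-1}\prod_{i=1}^N\bigl((1-sx_i)(1-tx_i)\bigr)^{-\kappa}, \] where $(1-u)^{-\kappa}=\sum_{k\ge 0}\frac{(\kappa)_k}{k!}u^k$ and $(a)_k=a(a+1)\cdots(a+k-1)$, and for $m\ge \ell$ let \[ \omega_{m\ell}=p_{m\ell}+\sum_{j=1}^{\ell}\frac{(-\kappa)_j\,(m-\ell+1)_{j-1}}{(\kappa+m-\ell+1)_j\,j!}\bigl((m-\ell+j)\,p_{m+j,\ell-j}+j\,p_{\ell-j,m+j}\bigr).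 \] Then $\omega_{nn}$ is a singular polynomial for $\kappa=-\frac{n}{N-1}$; that is, $\omega_{nn}\neq 0$ and $\mathcal D_i\,\omega_{nn}=0$ for all $1\le i\le N$. -/

import Mathlib

/-!
Polynomials in the variables `x_i` (`i : σ`, with `σ` finite) are elements of `MvPolynomial σ K`,
where `K` is a field of characteristic zero containing the parameter `κ`.
The transposition `(i,j)` acts by interchanging `x_i` and `x_j`.
-/

namespace SymDunkl

noncomputable section

variable {σ K : Type*}

/-- The polynomial `(i,j) f`, obtained from `f` by interchanging `x_i` and `x_j`. -/
def swapVars [DecidableEq σ] [Field K] (i j : σ) (f : MvPolynomial σ K) : MvPolynomial σ K :=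
  MvPolynomial.rename (Equiv.swap i j) f

theorem X_sub_X_dvd_sub_swapVars [DecidableEq σ] [Field K] (i j : σ) (f : MvPolynomial σ K) :
    (MvPolynomial.X i - MvPolynomial.X j : MvPolynomial σ K) ∣ f - swapVars i j f := by
  set I : Ideal (MvPolynomial σ K) := Ideal.span {MvPolynomial.X i - MvPolynomial.X j} with hI
  have hij : Ideal.Quotient.mkₐ K I (MvPolynomial.X i) =
      Ideal.Quotient.mkₐ K I (MvPolynomial.X j) :=
    Ideal.Quotient.eq.2 (Ideal.subset_span rfl)
  have h : (Ideal.Quotient.mkₐ K I).comp (MvPolynomial.rename (Equiv.swap i j)) =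
      Ideal.Quotient.mkₐ K I := by
    apply MvPolynomial.algHom_ext
    intro k
    rw [AlgHom.comp_apply, MvPolynomial.rename_X]
    rcases eq_or_ne k i with rfl | hki
    · rw [Equiv.swap_apply_left, hij]
    · rcases eq_or_ne k j with rfl | hkj
      · rw [Equiv.swap_apply_right, hij]
      · rw [Equiv.swap_apply_of_ne_of_ne hki hkj]
  rw [← Ideal.mem_span_singleton, ← hI]
  exact Ideal.Quotient.eq.1 (DFunLike.congr_fun h f).symm

/-- The polynomial `(f - (i,j) f) / (x_i - x_j)` for `i ≠ j`. -/
def divDiff [DecidableEq σ] [Field K] (i j : σ) (f : MvPolynomial σ K) : MvPolynomial σ K :=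
  Classical.choose (X_sub_X_dvd_sub_swapVars i j f)

theorem X_sub_X_mul_divDiff [DecidableEq σ] [Field K] (i j : σ) (f : MvPolynomial σ K) :
    (MvPolynomial.X i - MvPolynomial.X j) * divDiff i j f = f - swapVars i j f :=
  (Classical.choose_spec (X_sub_X_dvd_sub_swapVars i j f)).symm

/-- The Dunkl operator
`𝒟_i f = ∂f/∂x_i + κ ∑_{j ≠ i} (f - (i,j) f) / (x_i - x_j)`. -/
def dunkl [Fintype σ] [DecidableEq σ] [Field K] (κ : K) (i : σ) (f : MvPolynomial σ K) :
    MvPolynomial σ K :=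
  MvPolynomial.pderiv i f + MvPolynomial.C κ * ∑ j ∈ Finset.univ.erase i, divDiff i j f

/-- A singular polynomial for the parameter `κ`: nonzero and annihilated by all Dunkl operators. -/
def IsSingular [Fintype σ] [DecidableEq σ] [Field K] (κ : K) (f : MvPolynomial σ K) : Prop :=
  f ≠ 0 ∧ ∀ i : σ, dunkl κ i f = 0

/-- The Pochhammer symbol `(a)_k = a (a+1) ⋯ (a+k-1)`. -/
def poch [Field K] (a : K) (k : ℕ) : K :=
  ∏ i ∈ Finset.range k, (a + i)

/-- The power series `(1 - u x_i)^(-a) = ∑_k (a)_k / k! x_i^k u^k` in one variable `u`. -/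
def oneSubPow [Field K] (a : K) (i : σ) : PowerSeries (MvPolynomial σ K) :=
  PowerSeries.mk fun k => MvPolynomial.C (poch a k / (k.factorial : K)) * MvPolynomial.X i ^ k

/-- Power series in `s`, regarded as power series in `s` over the power series in `t`. -/
def inS [Field K] (F : PowerSeries (MvPolynomial σ K)) :
    PowerSeries (PowerSeries (MvPolynomial σ K)) :=
  PowerSeries.map PowerSeries.C F

/-- Power series in `t`, regarded as power series in `s` over the power series in `t`. -/
def inT [Field K] (F : PowerSeries (MvPolynomial σ K)) :
    PowerSeries (PowerSeries (MvPolynomial σ K)) :=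
  PowerSeries.C F

/-- The generating function
`(1 - s x_a)⁻¹ (1 - t x_b)⁻¹ ∏_i ((1 - s x_i) (1 - t x_i))^(-κ)`;
the indices `a`, `b` play the role of `1`, `2`. -/
def genFun [Fintype σ] [Field K] (κ : K) (a b : σ) :
    PowerSeries (PowerSeries (MvPolynomial σ K)) :=
  inS (oneSubPow 1 a) * inT (oneSubPow 1 b) *
    ∏ i : σ, (inS (oneSubPow κ i) * inT (oneSubPow κ i))

/-- `p_{mn}`, the coefficient of `s^m t^n` in the generating function. -/
def pPoly [Fintype σ] [Field K] (κ : K) (a b : σ) (m n : ℕ) : MvPolynomial σ K :=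
  PowerSeries.coeff n (PowerSeries.coeff m (genFun κ a b))

/-- `ω_{mn}` in the case `m ≥ n`. -/
def omegaOfGe [Fintype σ] [Field K] (κ : K) (a b : σ) (m n : ℕ) : MvPolynomial σ K :=
  pPoly κ a b m n + ∑ j ∈ Finset.Icc 1 n,
    MvPolynomial.C (poch (-κ) j * poch ((m : K) - n + 1) (j - 1) /
        (poch (κ + m - n + 1) j * (j.factorial : K))) *
      (MvPolynomial.C ((m : K) - n + j) * pPoly κ a b (m + j) (n - j) +
        MvPolynomial.C (j : K) * pPoly κ a b (n - j) (m + j))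

/-- `ω_{mn}` for all `m`, `n`, with `ω_{nm} = (1,2) ω_{mn}` for `m > n`. -/
def omega [Fintype σ] [DecidableEq σ] [Field K] (κ : K) (a b : σ) (m n : ℕ) :
    MvPolynomial σ K :=
  if n ≤ m then omegaOfGe κ a b m n else swapVars a b (omegaOfGe κ a b n m)

end

end SymDunkl

/-! The generating function separates: `p_{ml} = u_a(m) u_b(l)`, where `u_i(m)` is the coefficient
of `s^m` in `(1 - s x_i)⁻¹ ∏_k (1 - s x_k)^(-κ)`. At `m = ℓ = n` the coefficients collapse, and ω is
the convolution `∑_m w(m - n) p_{m,2n-m}` with the even weight `w(j) = (-κ)_{|j|} / (κ+1)_{|j|}`.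

Annihilation. For `i ≠ a, b` the operator `𝒟_i` kills every `p_{ml}` (`dunkl_pPoly_of_ne`). For `i =
a`, Euler's identity turns `𝒟_a p_{ml}` into `(m + Nκ) u_a(m-1) u_b(l)` plus `κ` times a cross term
symmetric in `m, l` (`dunkl_pPoly_left`). Since `(N-1)κ = -n`, the first factor is `κ + m - n`.
Summing outwards from `m = n`, the recurrence of `w` and the exchange identity `pPoly_sub_pPoly`
make the sum telescope (`dunkl_partial_sum`) to a term containing `u_a(-1) = 0` and a vanishing
cross term. The case `i = b` follows by symmetry.

Nonvanishing. Set `x_c = X`, `x_d = 1` and all other variables, including `x_a` and `x_b`, to `0`.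
The coefficient of `X^n` in ω is then a quadratic form in the Gegenbauer coefficients. A closed
formula for the weighted sums (`shiftSum_eq`) expresses orthogonality to lower frequencies: only the
two extreme terms survive, and they are equal and nonzero when `2κ` is not an integer. The gcd
hypothesis ensures the latter. -/

namespace SymDunkl

/-! ### Pochhammer identities and Gegenbauer orthogonality. -/

section Coefficients

open Finset.HasAntidiagonal (antidiagonal mem_antidiagonal)

variable {K : Type*} [Field K]

theorem poch_zero (a : K) : poch a 0 = 1 := by simp [poch]

theorem poch_succ (a : K) (k : ℕ) : poch a (k + 1) = poch a k * (a + k) := by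
  simp [poch, Finset.prod_range_succ]

theorem poch_succ' (a : K) (k : ℕ) : poch a (k + 1) = a * poch (a + 1) k := by
  rw [poch, Finset.prod_range_succ', mul_comm, poch]
  congr 1
  · simp
  · refine Finset.prod_congr rfl fun i _ => ?_
    push_cast
    ring

theorem poch_ne_zero {a : K} {k : ℕ} (h : ∀ i < k, a + i ≠ 0) : poch a k ≠ 0 :=
  Finset.prod_ne_zero_iff.2 fun i hi => h i (Finset.mem_range.1 hi)

/-- The coefficient `(a)_k / k!` of the binomial series `(1 - u)^(-a)`. -/
noncomputable def binCoeff (a : K) (k : ℕ) : K := poch a k / (k.factorial : K)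

theorem binCoeff_zero (a : K) : binCoeff a 0 = 1 := by simp [binCoeff, poch_zero]

theorem succ_mul_binCoeff_succ [CharZero K] (a : K) (k : ℕ) :
    ((k : K) + 1) * binCoeff a (k + 1) = (a + k) * binCoeff a k := by
  have h1 : (k : K) + 1 ≠ 0 := Nat.cast_add_one_ne_zero k
  have h2 : (k.factorial : K) ≠ 0 := Nat.cast_ne_zero.2 k.factorial_ne_zero
  rw [binCoeff, binCoeff, poch_succ, Nat.factorial_succ]
  push_cast
  field_simp

/-- The even sequence `(-κ)_{|j|} / (κ+1)_{|j|}` of weights in `ω_{nn}`. -/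
noncomputable def weight (κ : K) (j : ℤ) : K :=
  poch (-κ) j.natAbs / poch (κ + 1) j.natAbs

theorem weight_neg (κ : K) (j : ℤ) : weight κ (-j) = weight κ j := by simp [weight]

theorem weight_zero (κ : K) : weight κ 0 = 1 := by simp [weight, poch_zero]

theorem weight_natCast_succ {κ : K} (hκ : ∀ i : ℕ, κ + 1 + i ≠ 0) (j : ℕ) :
    (κ + 1 + j) * weight κ (j + 1 : ℕ) = (j - κ) * weight κ j := by
  have h := hκ j
  have h' : poch (κ + 1) j ≠ 0 := poch_ne_zero fun i _ => hκ i
  simp only [weight, Int.natAbs_natCast, poch_succ]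
  field_simp
  ring

/-- The recurrence is invariant under `j ↦ -1 - j` because the weight is even, so negative indices
reduce to natural ones. -/
theorem weight_succ {κ : K} (hκ : ∀ i : ℕ, κ + 1 + i ≠ 0) (j : ℤ) :
    (κ + 1 + j) * weight κ (j + 1) = (j - κ) * weight κ j := by
  rcases le_or_gt 0 j with hj | hj
  · lift j to ℕ using hj
    exact_mod_cast weight_natCast_succ hκ j
  · obtain ⟨k, rfl⟩ : ∃ k : ℕ, j = -(k + 1 : ℕ) := ⟨(-j - 1).toNat, by omega⟩
    have h := weight_natCast_succ hκ k
    have e : (-((k + 1 : ℕ) : ℤ)) + 1 = -(k : ℤ) := by push_cast; ring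
    rw [e, weight_neg, weight_neg]
    push_cast at h ⊢
    linear_combination h

/-- The weighted sum of the coefficients of `((1 - s) (1 - t))^(-κ)` in degree `n`, the weights
being translated by `j`. -/
noncomputable def shiftSum (κ : K) (n : ℕ) (j : ℤ) : K :=
  ∑ x ∈ antidiagonal n, binCoeff κ x.1 * binCoeff κ x.2 * weight κ (j + x.1)

theorem sum_antidiagonal_fst_mul [CharZero K] (κ : K) (n : ℕ) (f : ℕ → K) :
    ∑ x ∈ antidiagonal (n + 1), x.1 * (binCoeff κ x.1 * binCoeff κ x.2 * f x.1) =
      ∑ x ∈ antidiagonal n,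
        (κ + x.1) * (binCoeff κ x.1 * binCoeff κ x.2 * f (x.1 + 1)) := by
  rw [Finset.Nat.sum_antidiagonal_succ]
  simp only [Nat.cast_zero, zero_mul, zero_add]
  refine Finset.sum_congr rfl fun x _ => ?_
  have := succ_mul_binCoeff_succ κ x.1
  push_cast
  linear_combination (binCoeff κ x.2 * f (x.1 + 1)) * this

theorem sum_antidiagonal_snd_mul [CharZero K] (κ : K) (n : ℕ) (f : ℕ → K) :
    ∑ x ∈ antidiagonal (n + 1), x.2 * (binCoeff κ x.1 * binCoeff κ x.2 * f x.1) =
      ∑ x ∈ antidiagonal n,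
        (κ + x.2) * (binCoeff κ x.1 * binCoeff κ x.2 * f x.1) := by
  rw [Finset.Nat.sum_antidiagonal_succ']
  simp only [Nat.cast_zero, zero_mul, zero_add]
  refine Finset.sum_congr rfl fun x _ => ?_
  have := succ_mul_binCoeff_succ κ x.2
  push_cast
  linear_combination (binCoeff κ x.1 * f x.1) * this

/-- This is the three-term Gegenbauer recurrence in homogeneous form, with multiplication by a
variable read as a shift of `j`. It holds for arbitrary weights: only the recurrence of `binCoeff`
enters. -/
theorem shiftSum_rec [CharZero K] (κ : K) (n : ℕ) (j : ℤ) :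
    ((n : K) + 2) * shiftSum κ (n + 2) j =
      (n + 1 + κ) * (shiftSum κ (n + 1) (j + 1) + shiftSum κ (n + 1) j) -
        (n + 2 * κ) * shiftSum κ n (j + 1) := by
  have key (m : ℕ) (i : ℤ) (k : K) : ((m : K) + k) * shiftSum κ m i =
      ∑ x ∈ antidiagonal m,
        (x.1 + x.2 + k) * (binCoeff κ x.1 * binCoeff κ x.2 * weight κ (i + x.1)) := by
    rw [shiftSum, Finset.mul_sum]
    refine Finset.sum_congr rfl fun x hx => ?_
    rw [← mem_antidiagonal.1 hx]
    push_cast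
    ring
  have h1 := sum_antidiagonal_fst_mul κ (n + 1) fun p => weight κ (j + p)
  have h2 := sum_antidiagonal_snd_mul κ (n + 1) fun p => weight κ (j + p)
  have h3 := sum_antidiagonal_fst_mul κ n fun p => weight κ (j + p)
  have h4 := sum_antidiagonal_snd_mul κ n fun p => weight κ (j + 1 + p)
  have e (p : ℕ) : j + ((p + 1 : ℕ) : ℤ) = j + 1 + p := by push_cast; ring
  simp only [e] at h1 h3
  have k1 := key (n + 2) j 0
  have k2 := key (n + 1) (j + 1) κ
  have k3 := key (n + 1) j κ
  have k4 := key n (j + 1) (2 * κ)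
  have s4 : ∀ x : ℕ × ℕ, ((x.1 : K) + x.2 + 2 * κ) *
      (binCoeff κ x.1 * binCoeff κ x.2 * weight κ (j + 1 + x.1)) =
      (κ + x.1) * (binCoeff κ x.1 * binCoeff κ x.2 * weight κ (j + 1 + x.1)) +
      (κ + x.2) * (binCoeff κ x.1 * binCoeff κ x.2 * weight κ (j + 1 + x.1)) := fun x => by ring
  simp only [s4] at k4
  simp only [add_mul, add_zero, Finset.sum_add_distrib] at *
  push_cast at *
  linear_combination k1 + h1 + h2 - k2 - k3 + k4 - h3 - h4

theorem shiftSum_eq [CharZero K] {κ : K} (hκ : ∀ z : ℤ, κ + z ≠ 0) (n : ℕ) (j : ℤ) :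
    shiftSum κ (n + 1) j = poch (2 * κ) (n + 1) / (2 * ((n + 1).factorial : K)) *
      (n + 1 + 2 * j) * poch ((j : K) + 1) n * weight κ j / poch (κ + j + 1) (n + 1) := by
  have hκ' : ∀ i : ℕ, κ + 1 + i ≠ 0 := fun i => by
    have := hκ (1 + i); push_cast at this; rwa [add_assoc]
  have hw (j : ℤ) : weight κ (j + 1) = (j - κ) * weight κ j / (κ + j + 1) := by
    have h := hκ (j + 1)
    push_cast at h
    rw [← add_assoc] at h
    rw [eq_div_iff h, ← weight_succ hκ']
    ring
  have hone (j : ℤ) : shiftSum κ 1 j = κ * (2 * j + 1) * weight κ j / (κ + j + 1) := by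
    have h := hκ (j + 1)
    push_cast at h
    rw [← add_assoc] at h
    have hb : binCoeff κ 1 = κ := by simp [binCoeff, poch]
    simp [shiftSum, Finset.Nat.antidiagonal_succ, binCoeff_zero, hb, hw]
    field_simp
    ring
  have hzero (j : ℤ) : shiftSum κ 0 j = weight κ j := by
    simp [shiftSum, binCoeff_zero]
  induction n using Nat.strong_induction_on generalizing j with
  | _ n ih =>
    have d1 := hκ (j + 1)
    have d2 := hκ (j + 2)
    push_cast at d1 d2
    rw [← add_assoc] at d1 d2
    match n, ih with
    | 0, _ =>
      rw [hone]
      simp [poch]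
      field_simp
      ring
    -- Degree two needs its own case: the recurrence reaches down to degree zero, which the closed
    -- form does not cover.
    | 1, _ =>
      have h := shiftSum_rec κ 0 j
      have d3 : κ + (j + 1) + 1 ≠ 0 := by convert d2 using 1; ring
      have d4 : κ + j + 1 + 1 ≠ 0 := by convert d2 using 1; ring
      rw [zero_add, zero_add, hone, hone, hzero, hw] at h
      simp [poch, Finset.prod_range_succ, Nat.factorial] at h ⊢
      rw [← mul_right_inj' (two_ne_zero (α := K)), h]
      field_simp
      ring
    | m + 2, ih =>
      have h := shiftSum_rec κ (m + 1) j
      rw [ih (m + 1) (by omega), ih (m + 1) (by omega), ih m (by omega), hw] at h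
      have hm3 : (m : K) + 3 ≠ 0 := by exact_mod_cast (by omega : m + 3 ≠ 0)
      have hm2 : (m : K) + 2 ≠ 0 := by exact_mod_cast (by omega : m + 2 ≠ 0)
      have hm1 : (m : K) + 1 ≠ 0 := by exact_mod_cast (by omega : m + 1 ≠ 0)
      have hf : (m.factorial : K) ≠ 0 := Nat.cast_ne_zero.2 m.factorial_ne_zero
      have a1 := hκ (j + 2 + m)
      have a2 := hκ (j + 3 + m)
      have hQ : poch (κ + j + 2) m ≠ 0 := poch_ne_zero fun i _ => by
        have := hκ (j + 2 + i); push_cast at this; convert this using 1; ring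
      push_cast at a1 a2 h
      have hm : ((m : K) + 1 + 2) = m + 3 := by ring
      rw [hm] at h
      rw [← mul_right_inj' hm3]
      refine h.trans ?_
      -- All Pochhammer symbols are reduced to `(j+2)_m`, `(κ+j+2)_m` and `(2κ)_{m+1}`, which leaves
      -- an identity of rational functions.
      have r1 : poch ((j : K) + 1) (m + 2) =
          (j + 1) * (poch ((j : K) + 2) m * (j + 2 + m)) := by
        rw [poch_succ', poch_succ]; ring_nf
      have r2 : poch ((j : K) + 1 + 1) (m + 1) = poch ((j : K) + 2) m * (j + 2 + m) := by
        rw [poch_succ]; ring_nf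
      have r3 : poch ((j : K) + 1) (m + 1) = (j + 1) * poch ((j : K) + 2) m := by
        rw [poch_succ']; ring_nf
      have r4 : poch ((j : K) + 1 + 1) m = poch ((j : K) + 2) m := by ring_nf
      have q1 : poch (κ + j + 1) (m + 2 + 1) = (κ + j + 1) *
          (poch (κ + j + 2) m * (κ + (j + 2 + m)) * (κ + (j + 3 + m))) := by
        rw [poch_succ', poch_succ, poch_succ]; push_cast; ring_nf
      have q2 : poch (κ + (j + 1) + 1) (m + 1 + 1) =
          poch (κ + j + 2) m * (κ + (j + 2 + m)) * (κ + (j + 3 + m)) := by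
        rw [poch_succ, poch_succ]; push_cast; ring_nf
      have q3 : poch (κ + j + 1) (m + 1 + 1) = (κ + j + 1) *
          (poch (κ + j + 2) m * (κ + (j + 2 + m))) := by
        rw [poch_succ', poch_succ]; ring_nf
      have q4 : poch (κ + (j + 1) + 1) (m + 1) =
          poch (κ + j + 2) m * (κ + (j + 2 + m)) := by
        rw [poch_succ]; ring_nf
      have t1 : poch (2 * κ) (m + 2 + 1) =
          poch (2 * κ) (m + 1) * (2 * κ + m + 1) * (2 * κ + m + 2) := by
        rw [poch_succ, poch_succ]; push_cast; ring
      have t2 : poch (2 * κ) (m + 1 + 1) = poch (2 * κ) (m + 1) * (2 * κ + m + 1) := by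
        rw [poch_succ]; push_cast; ring
      rw [r1, r2, r3, r4, q1, q2, q3, q4, t1, t2]
      simp only [Nat.factorial_succ]
      push_cast
      generalize poch (κ + j + 2) m = Q at *
      generalize poch ((j : K) + 2) m = P at *
      generalize poch (2 * κ) (m + 1) = T at *
      have hm3' : (m : K) + 2 + 1 ≠ 0 := by convert hm3 using 1; ring
      have hm2' : (m : K) + 1 + 1 ≠ 0 := by convert hm2 using 1; ring
      field_simp
      ring

/-- Exchange the two factors and use that the weight is even. -/
theorem shiftSum_neg_self (κ : K) (n : ℕ) : shiftSum κ n (-n) = shiftSum κ n 0 := by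
  rw [shiftSum, shiftSum, ← Finset.Nat.sum_antidiagonal_swap]
  refine Finset.sum_congr rfl fun x hx => ?_
  have hx := mem_antidiagonal.1 hx
  rw [← weight_neg, Prod.fst_swap, Prod.snd_swap, mul_comm (binCoeff κ x.2)]
  congr 2
  omega

/-- The squared norm of the Gegenbauer polynomial of degree `n` does not vanish. -/
theorem sum_binCoeff_mul_shiftSum_ne_zero [CharZero K] {κ : K} (hκ : ∀ z : ℤ, 2 * κ + z ≠ 0)
    {n : ℕ} (hn : 1 ≤ n) :
    ∑ x ∈ antidiagonal n,
      binCoeff κ x.1 * binCoeff κ x.2 * shiftSum κ n (-(x.1 : ℤ)) ≠ 0 := by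
  have hκ1 : ∀ z : ℤ, κ + z ≠ 0 := fun z h => hκ (2 * z) (by
    push_cast; linear_combination 2 * h)
  obtain ⟨n, rfl⟩ : ∃ m, n = m + 1 := ⟨n - 1, by omega⟩
  -- Orthogonality: `(j+1)_n` in the closed form vanishes for `j = -1, …, -n`.
  have hmid : ∀ p < n, shiftSum κ (n + 1) (-((p + 1 : ℕ) : ℤ)) = 0 := fun p hp => by
    rw [shiftSum_eq hκ1]
    have : poch (((-((p + 1 : ℕ) : ℤ) : ℤ) : K) + 1) n = 0 :=
      Finset.prod_eq_zero (Finset.mem_range.2 hp) (by push_cast; ring)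
    rw [this]
    simp
  -- Only the endpoints `(0, n+1)` and `(n+1, 0)` remain; both contribute `binCoeff κ (n+1) *
  -- shiftSum κ (n+1) 0`.
  rw [Finset.Nat.sum_antidiagonal_succ, Finset.sum_eq_single (n, 0)]
  · have hb : binCoeff κ (n + 1) ≠ 0 := div_ne_zero
      (poch_ne_zero fun i _ => by simpa using hκ1 i)
      (Nat.cast_ne_zero.2 (Nat.factorial_ne_zero _))
    have h0 : shiftSum κ (n + 1) 0 ≠ 0 := by
      rw [shiftSum_eq hκ1, weight_zero]
      have h1 : poch (2 * κ) (n + 1) ≠ 0 := poch_ne_zero fun i _ => by simpa using hκ i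
      have h2 : poch (((0 : ℤ) : K) + 1) n ≠ 0 := poch_ne_zero fun i _ => by
        have : (1 : K) + i ≠ 0 := by rw [add_comm]; exact Nat.cast_add_one_ne_zero i
        simpa using this
      have h3 : poch (κ + ((0 : ℤ) : K) + 1) (n + 1) ≠ 0 := poch_ne_zero fun i _ => by
        have := hκ1 (1 + i); push_cast at this; simpa [add_assoc] using this
      have h4 : (n : K) + 1 + 2 * ((0 : ℤ) : K) ≠ 0 := by
        simpa using Nat.cast_add_one_ne_zero (R := K) n
      have h5 : (2 : K) * ((n + 1).factorial : K) ≠ 0 :=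
        mul_ne_zero two_ne_zero (Nat.cast_ne_zero.2 (Nat.factorial_ne_zero _))
      exact div_ne_zero (mul_ne_zero (mul_ne_zero (mul_ne_zero (div_ne_zero h1 h5) h4) h2)
        one_ne_zero) h3
    simp only [shiftSum_neg_self, binCoeff_zero, Nat.cast_zero, neg_zero]
    have : (2 : K) * binCoeff κ (n + 1) * shiftSum κ (n + 1) 0 ≠ 0 :=
      mul_ne_zero (mul_ne_zero two_ne_zero hb) h0
    convert this using 1
    ring
  · intro x hx hne
    have hx := mem_antidiagonal.1 hx
    have : x.1 < n := by
      rcases Nat.eq_zero_or_pos x.2 with h | h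
      · exact absurd (Prod.ext (by simpa [h] using hx) h) hne
      · omega
    rw [hmid _ this, mul_zero]
  · intro h
    simp at h

end Coefficients

/-! ### Power series and the factorization of the generating function. -/

section Series

open MvPolynomial (pderiv rename)
open PowerSeries (coeff map)

variable {σ K : Type*} [Field K]

local notation "R" => MvPolynomial σ K

theorem coeff_oneSubPow (a : K) (i : σ) (k : ℕ) :
    coeff k (oneSubPow a i) = MvPolynomial.C (binCoeff a k) * MvPolynomial.X i ^ k := by
  rw [oneSubPow, PowerSeries.coeff_mk, binCoeff]

theorem coeff_oneSubPow_one [CharZero K] (i : σ) (k : ℕ) :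
    coeff k (oneSubPow (1 : K) i) = MvPolynomial.X i ^ k := by
  have h : binCoeff (1 : K) k = 1 := by
    induction k with
    | zero => exact binCoeff_zero 1
    | succ k ih =>
      have h := succ_mul_binCoeff_succ (1 : K) k
      rw [ih, mul_one, add_comm (1 : K)] at h
      exact mul_left_cancel₀ (Nat.cast_add_one_ne_zero k) (h.trans (mul_one _).symm)
  rw [coeff_oneSubPow, h, map_one, one_mul]

theorem oneSubPow_one_eq [CharZero K] (i : σ) :
    oneSubPow (1 : K) i =
      1 + PowerSeries.C (MvPolynomial.X i : R) * PowerSeries.X * oneSubPow (1 : K) i := by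
  ext1 k
  cases k with
  | zero => simp [mul_assoc, coeff_oneSubPow_one]
  | succ k => simp [mul_assoc, coeff_oneSubPow_one, PowerSeries.coeff_one, pow_succ']

/-- The derivation of power series that acts on the coefficients by `∂/∂x_i`. -/
noncomputable def seriesPderiv (i : σ) :
    Derivation K (PowerSeries (MvPolynomial σ K)) (PowerSeries (MvPolynomial σ K)) :=
  Derivation.mk'
    { toFun := fun F => PowerSeries.mk fun m => pderiv i (coeff m F)
      map_add' := fun F H => by ext1 m; simp
      map_smul' := fun c F => by ext1 m; simp }
    fun F H => by
      ext1 m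
      simp only [LinearMap.coe_mk, AddHom.coe_mk, PowerSeries.coeff_mk, PowerSeries.coeff_mul,
        map_sum, Derivation.leibniz, smul_eq_mul, map_add, Finset.sum_add_distrib]
      congr 1
      rw [← Finset.Nat.sum_antidiagonal_swap]
      rfl

theorem coeff_seriesPderiv (i : σ) (F : PowerSeries R) (m : ℕ) :
    coeff m (seriesPderiv i F) = pderiv i (coeff m F) := by
  simp [seriesPderiv]

theorem seriesPderiv_oneSubPow_of_ne {i j : σ} (h : j ≠ i) (a : K) :
    seriesPderiv i (oneSubPow a j) = 0 := by
  ext1 m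
  rw [coeff_seriesPderiv, coeff_oneSubPow]
  simp [MvPolynomial.pderiv_X_of_ne h]

theorem coeff_sub_mul (i : σ) (F : PowerSeries R) (m : ℕ) :
    coeff (m + 1) ((1 - PowerSeries.C (MvPolynomial.X i : R) * PowerSeries.X) * F) =
      coeff (m + 1) F - MvPolynomial.X i * coeff m F := by
  simp [sub_mul, mul_assoc]

theorem coeff_zero_sub_mul (i : σ) (F : PowerSeries R) :
    coeff 0 ((1 - PowerSeries.C (MvPolynomial.X i : R) * PowerSeries.X) * F) = coeff 0 F := by
  simp [sub_mul, mul_assoc]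

theorem oneSubPow_one_mul_sub [CharZero K] (i : σ) :
    oneSubPow (1 : K) i * (1 - PowerSeries.C (MvPolynomial.X i : R) * PowerSeries.X) = 1 := by
  linear_combination oneSubPow_one_eq (K := K) i

/-- Clear the denominator `1 - s x_i`, compare coefficients, then multiply back by its inverse
series. -/
theorem seriesPderiv_oneSubPow_self [CharZero K] (i : σ) (a : K) :
    seriesPderiv i (oneSubPow a i) = PowerSeries.C (MvPolynomial.C a : R) *
      (PowerSeries.X * oneSubPow (1 : K) i * oneSubPow a i) := by
  have h : (1 - PowerSeries.C (MvPolynomial.X i : R) * PowerSeries.X) *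
      seriesPderiv i (oneSubPow a i) =
      PowerSeries.C (MvPolynomial.C a) * (PowerSeries.X * oneSubPow a i) := by
    ext1 m
    match m with
    | 0 =>
      rw [coeff_zero_sub_mul, PowerSeries.coeff_C_mul, PowerSeries.coeff_zero_X_mul,
        coeff_seriesPderiv, coeff_oneSubPow]
      simp
    | 1 =>
      have := succ_mul_binCoeff_succ a 0
      simp [binCoeff_zero] at this
      rw [coeff_sub_mul]
      simp [coeff_seriesPderiv, coeff_oneSubPow, binCoeff_zero, this,
        -PowerSeries.coeff_zero_eq_constantCoeff]
    | m + 2 =>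
      have := congrArg (MvPolynomial.C (σ := σ)) (succ_mul_binCoeff_succ a (m + 1))
      rw [coeff_sub_mul]
      simp only [coeff_seriesPderiv, coeff_oneSubPow, PowerSeries.coeff_C_mul,
        PowerSeries.coeff_succ_X_mul, Derivation.leibniz, MvPolynomial.pderiv_C,
        Derivation.leibniz_pow, MvPolynomial.pderiv_X_self, smul_eq_mul, mul_one,
        nsmul_eq_mul, Nat.add_sub_cancel]
      simp only [map_mul, map_add, map_one, map_natCast] at this
      push_cast at this ⊢
      linear_combination MvPolynomial.X i ^ (m + 1) * this
  linear_combination oneSubPow (1 : K) i * h -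
    seriesPderiv i (oneSubPow a i) * oneSubPow_one_mul_sub (K := K) i

theorem derivative_oneSubPow [CharZero K] (i : σ) (a : K) :
    PowerSeries.derivative R (oneSubPow a i) =
      PowerSeries.C (MvPolynomial.C a * MvPolynomial.X i : R) *
        (oneSubPow (1 : K) i * oneSubPow a i) := by
  have h : (1 - PowerSeries.C (MvPolynomial.X i : R) * PowerSeries.X) *
      PowerSeries.derivative R (oneSubPow a i) =
      PowerSeries.C (MvPolynomial.C a * MvPolynomial.X i : R) * oneSubPow a i := by
    ext1 m
    match m with
    | 0 =>
      have := succ_mul_binCoeff_succ a 0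
      simp [binCoeff_zero] at this
      rw [coeff_zero_sub_mul, PowerSeries.coeff_derivative, PowerSeries.coeff_C_mul]
      simp [coeff_oneSubPow, binCoeff_zero, this, -PowerSeries.coeff_zero_eq_constantCoeff]
    | m + 1 =>
      have := congrArg (MvPolynomial.C (σ := σ)) (succ_mul_binCoeff_succ a (m + 1))
      rw [coeff_sub_mul, PowerSeries.coeff_derivative, PowerSeries.coeff_derivative,
        PowerSeries.coeff_C_mul]
      simp only [coeff_oneSubPow]
      simp only [map_mul, map_add, map_one, map_natCast] at this
      push_cast at this ⊢
      linear_combination MvPolynomial.X i ^ (m + 2) * this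
  linear_combination oneSubPow (1 : K) i * h -
    PowerSeries.derivative R (oneSubPow a i) * oneSubPow_one_mul_sub (K := K) i

theorem map_rename_oneSubPow (e : σ → σ) (a : K) (i : σ) :
    map (rename e : R →ₐ[K] R).toRingHom (oneSubPow a i) = oneSubPow a (e i) := by
  ext1 m
  simp [coeff_oneSubPow]

theorem oneSubPow_one_sub [CharZero K] (i j : σ) :
    oneSubPow (1 : K) i - oneSubPow (1 : K) j =
      PowerSeries.C (MvPolynomial.X i - MvPolynomial.X j : R) *
        (PowerSeries.X * oneSubPow (1 : K) i * oneSubPow (1 : K) j) := by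
  rw [map_sub]
  linear_combination oneSubPow (1 : K) j * oneSubPow_one_mul_sub (K := K) i -
    oneSubPow (1 : K) i * oneSubPow_one_mul_sub (K := K) j

theorem swapVars_mul [DecidableEq σ] (i j : σ) (f g : R) :
    swapVars i j (f * g) = swapVars i j f * swapVars i j g := by
  simp [swapVars]

variable [Fintype σ]

/-- The symmetric series `∏_i (1 - s x_i)^(-κ)`. -/
noncomputable def symSeries (σ : Type*) [Fintype σ] (κ : K) : PowerSeries (MvPolynomial σ K) :=
  ∏ i : σ, oneSubPow κ i

theorem seriesPderiv_symSeries [CharZero K] (κ : K) (i : σ) :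
    seriesPderiv i (symSeries σ κ) = PowerSeries.C (MvPolynomial.C κ : R) *
      (PowerSeries.X * oneSubPow (1 : K) i * symSeries σ κ) := by
  classical
  have h : ∀ s : Finset σ, i ∉ s → seriesPderiv i (∏ j ∈ s, oneSubPow κ j) = 0 := by
    intro s
    induction s using Finset.induction_on with
    | empty => simp
    | insert j s hj ih =>
      intro hi
      rw [Finset.mem_insert, not_or] at hi
      rw [Finset.prod_insert hj, Derivation.leibniz, ih hi.2,
        seriesPderiv_oneSubPow_of_ne (Ne.symm hi.1)]
      simp
  rw [symSeries, ← Finset.mul_prod_erase _ _ (Finset.mem_univ i), Derivation.leibniz,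
    h _ (Finset.notMem_erase i _), seriesPderiv_oneSubPow_self]
  simp only [smul_eq_mul]
  ring

theorem derivative_symSeries [CharZero K] (κ : K) :
    PowerSeries.derivative R (symSeries σ κ) =
      ∑ i : σ, PowerSeries.C (MvPolynomial.C κ * MvPolynomial.X i : R) *
        (oneSubPow (1 : K) i * symSeries σ κ) := by
  classical
  have h : ∀ s : Finset σ, PowerSeries.derivative R (∏ j ∈ s, oneSubPow κ j) =
      ∑ i ∈ s, PowerSeries.C (MvPolynomial.C κ * MvPolynomial.X i : R) *
        (oneSubPow (1 : K) i * ∏ j ∈ s, oneSubPow κ j) := by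
    intro s
    induction s using Finset.induction_on with
    | empty => simp
    | insert j s hj ih =>
      rw [Finset.prod_insert hj, Derivation.leibniz, ih, derivative_oneSubPow,
        Finset.sum_insert hj, add_comm]
      simp only [smul_eq_mul]
      refine congrArg₂ (· + ·) ?_ ?_
      · ring
      · rw [Finset.mul_sum]
        exact Finset.sum_congr rfl fun k _ => by ring
  exact h _

theorem map_rename_symSeries (e : Equiv.Perm σ) (κ : K) :
    map (rename e : R →ₐ[K] R).toRingHom (symSeries σ κ) = symSeries σ κ := by
  rw [symSeries, map_prod]
  simp only [map_rename_oneSubPow]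
  exact Equiv.prod_comp e fun i => oneSubPow κ i

/-- The coefficient of `s^m` in `(1 - s x_i)⁻¹ ∏_k (1 - s x_k)^(-κ)`. -/
noncomputable def uPoly (κ : K) (i : σ) (m : ℕ) : MvPolynomial σ K :=
  coeff m (oneSubPow (1 : K) i * symSeries σ κ)

/-- The coefficient of `s^m` in `s (1 - s x_i)⁻¹ ∏_k (1 - s x_k)^(-κ)`. -/
noncomputable def uPred (κ : K) (i : σ) (m : ℕ) : MvPolynomial σ K :=
  coeff m (PowerSeries.X * (oneSubPow (1 : K) i * symSeries σ κ))

/-- The coefficient of `s^m` in `s (1 - s x_i)⁻¹ (1 - s x_j)⁻¹ ∏_k (1 - s x_k)^(-κ)`. -/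
noncomputable def wPoly (κ : K) (i j : σ) (m : ℕ) : MvPolynomial σ K :=
  coeff m (PowerSeries.X * oneSubPow (1 : K) i * oneSubPow (1 : K) j * symSeries σ κ)

theorem uPred_zero (κ : K) (i : σ) : uPred κ i 0 = 0 := by simp [uPred]

theorem uPred_succ (κ : K) (i : σ) (m : ℕ) : uPred κ i (m + 1) = uPoly κ i m := by
  simp [uPred, uPoly, PowerSeries.coeff_succ_X_mul]

theorem wPoly_zero (κ : K) (i j : σ) : wPoly κ i j 0 = 0 := by
  simp [wPoly]

theorem wPoly_comm (κ : K) (i j : σ) (m : ℕ) : wPoly κ i j m = wPoly κ j i m := by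
  simp only [wPoly, mul_right_comm]

theorem wPoly_succ [CharZero K] (κ : K) (i j : σ) (m : ℕ) :
    wPoly κ i j (m + 1) = MvPolynomial.X i * wPoly κ i j m + uPoly κ j m := by
  have h : PowerSeries.X * oneSubPow (1 : K) i * oneSubPow (1 : K) j * symSeries σ κ =
      PowerSeries.X * (PowerSeries.C (MvPolynomial.X i : R) *
        (PowerSeries.X * oneSubPow (1 : K) i * oneSubPow (1 : K) j * symSeries σ κ) +
          oneSubPow (1 : K) j * symSeries σ κ) := by
    linear_combination (PowerSeries.X * oneSubPow (1 : K) j * symSeries σ κ) *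
      oneSubPow_one_eq (K := K) i
  rw [wPoly, h, PowerSeries.coeff_succ_X_mul, map_add, PowerSeries.coeff_C_mul]
  rfl

theorem uPoly_sub [CharZero K] (κ : K) (i j : σ) (m : ℕ) :
    uPoly κ i m - uPoly κ j m =
      (MvPolynomial.X i - MvPolynomial.X j) * wPoly κ i j m := by
  rw [uPoly, uPoly, wPoly, ← PowerSeries.coeff_C_mul, ← map_sub]
  congr 1
  linear_combination symSeries σ κ * oneSubPow_one_sub (K := K) i j

theorem pderiv_uPoly_of_ne [CharZero K] (κ : K) {i j : σ} (h : j ≠ i) (m : ℕ) :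
    pderiv i (uPoly κ j m) = MvPolynomial.C κ * wPoly κ i j m := by
  rw [uPoly, wPoly, ← coeff_seriesPderiv, ← PowerSeries.coeff_C_mul, Derivation.leibniz,
    seriesPderiv_symSeries, seriesPderiv_oneSubPow_of_ne h]
  congr 1
  simp only [smul_eq_mul]
  ring

theorem pderiv_uPoly_self [CharZero K] (κ : K) (i : σ) (m : ℕ) :
    pderiv i (uPoly κ i m) = MvPolynomial.C (1 + κ) * wPoly κ i i m := by
  rw [uPoly, wPoly, ← coeff_seriesPderiv, ← PowerSeries.coeff_C_mul, Derivation.leibniz,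
    seriesPderiv_symSeries, seriesPderiv_oneSubPow_self]
  congr 1
  simp only [smul_eq_mul, map_add, map_one]
  ring

/-- Logarithmic differentiation by `s d/ds`: writing `s x_k (1 - s x_k)⁻¹` as `(1 - s x_k)⁻¹ - 1`,
the subtracted ones produce the constant `1 + Nκ`. -/
theorem euler_uPred [CharZero K] (κ : K) (i : σ) (m : ℕ) :
    MvPolynomial.C (m + Fintype.card σ * κ) * uPred κ i m =
      wPoly κ i i m + MvPolynomial.C κ * ∑ k : σ, wPoly κ i k m := by
  set A := oneSubPow (1 : K) i with hA
  set G := symSeries σ κ with hG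
  have hd : PowerSeries.X * PowerSeries.derivative R (A * G) =
      (A - 1) * (A * G) + PowerSeries.C (MvPolynomial.C κ : R) *
        ∑ k : σ, (oneSubPow (1 : K) k - 1) * (A * G) := by
    rw [Derivation.leibniz, derivative_symSeries, hA, derivative_oneSubPow, ← hA]
    simp only [smul_eq_mul, mul_add, Finset.mul_sum, map_mul, map_one, one_mul]
    rw [add_comm]
    refine congrArg₂ (· + ·) ?_ ?_
    · have := oneSubPow_one_eq (K := K) i
      linear_combination (-(A * G)) * this
    · refine Finset.sum_congr rfl fun k _ => ?_
      have := oneSubPow_one_eq (K := K) k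
      linear_combination (-(PowerSeries.C (MvPolynomial.C κ : R) * (A * G))) * this
  cases m with
  | zero => simp [uPred_zero, wPoly_zero]
  | succ m =>
    have h := congrArg (coeff m) hd
    have hs : ∀ k, wPoly κ i k (m + 1) = coeff m (A * oneSubPow (1 : K) k * G) := fun k => by
      rw [wPoly, mul_assoc, mul_assoc, PowerSeries.coeff_succ_X_mul, mul_assoc]
    have hX : coeff m (PowerSeries.X * PowerSeries.derivative R (A * G)) =
        m * coeff m (A * G) := by
      cases m with
      | zero => simp
      | succ m =>
        rw [PowerSeries.coeff_succ_X_mul, PowerSeries.coeff_derivative, mul_comm]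
        push_cast
        rfl
    have hk : ∀ k, coeff m ((oneSubPow (1 : K) k - 1) * (A * G)) =
        wPoly κ i k (m + 1) - uPoly κ i m := fun k => by
      rw [hs, uPoly, ← map_sub]
      congr 1
      ring
    rw [hX, map_add, PowerSeries.coeff_C_mul, map_sum, hk] at h
    simp only [hk, Finset.sum_sub_distrib, Finset.sum_const, Finset.card_univ,
      nsmul_eq_mul] at h
    rw [uPred_succ]
    have hu : coeff m (A * G) = uPoly κ i m := rfl
    rw [hu] at h
    simp only [map_add, map_mul, map_natCast]
    push_cast
    linear_combination h

theorem pPoly_eq (κ : K) (a b : σ) (m l : ℕ) :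
    pPoly κ a b m l = uPoly κ a m * uPoly κ b l := by
  have h : genFun κ a b = inS (oneSubPow 1 a * symSeries σ κ) *
      inT (oneSubPow 1 b * symSeries σ κ) := by
    simp only [genFun, symSeries, inS, inT, Finset.prod_mul_distrib, map_mul, map_prod]
    ring
  rw [pPoly, h, inS, inT, PowerSeries.coeff_mul_C, PowerSeries.coeff_map,
    PowerSeries.coeff_C_mul]
  rfl

/-- The term of `𝒟_a p_{ml}` that comes from the interaction of `x_a` and `x_b`. -/
noncomputable def crossTerm (κ : K) (a b : σ) (m l : ℕ) : MvPolynomial σ K :=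
  (MvPolynomial.X a - MvPolynomial.X b) * (wPoly κ a b m * wPoly κ a b l)

/-- Each `u` is `w(m+1)` minus a variable times `w(m)`; after expansion only terms with the factor
`x_a - x_b` survive. This exchange drives the telescoping. -/
theorem pPoly_sub_pPoly [CharZero K] (κ : K) (a b : σ) (m l : ℕ) :
    pPoly κ a b m l - pPoly κ a b l m = crossTerm κ a b m (l + 1) - crossTerm κ a b (m + 1) l := by
  have h1 := wPoly_succ κ a b m
  have h2 := wPoly_succ κ b a m
  have h3 := wPoly_succ κ a b l
  have h4 := wPoly_succ κ b a l
  simp only [wPoly_comm κ b a] at h2 h4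
  rw [pPoly_eq, pPoly_eq, crossTerm, crossTerm]
  have e1 : uPoly κ b m = wPoly κ a b (m + 1) - MvPolynomial.X a * wPoly κ a b m := by
    rw [h1]; ring
  have e2 : uPoly κ a m = wPoly κ a b (m + 1) - MvPolynomial.X b * wPoly κ a b m := by
    rw [h2]; ring
  have e3 : uPoly κ b l = wPoly κ a b (l + 1) - MvPolynomial.X a * wPoly κ a b l := by
    rw [h3]; ring
  have e4 : uPoly κ a l = wPoly κ a b (l + 1) - MvPolynomial.X b * wPoly κ a b l := by
    rw [h4]; ring
  rw [e1, e2, e3, e4]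
  ring

theorem swapVars_uPoly [DecidableEq σ] (κ : K) (i j k : σ) (m : ℕ) :
    swapVars i j (uPoly κ k m) = uPoly κ (Equiv.swap i j k) m := by
  have : swapVars i j (uPoly κ k m) =
      (rename (Equiv.swap i j) : R →ₐ[K] R).toRingHom (uPoly κ k m) := rfl
  rw [this, uPoly, ← PowerSeries.coeff_map, map_mul, map_rename_oneSubPow,
    map_rename_symSeries, uPoly]

end Series

/-! ### Dunkl operators on the products `p_{ml}`. -/

section Dunkl

open MvPolynomial (pderiv)

variable {σ K : Type*} [Field K] [DecidableEq σ]

theorem divDiff_eq {i j : σ} (hij : i ≠ j) {f g : MvPolynomial σ K}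
    (h : (MvPolynomial.X i - MvPolynomial.X j) * g = f - swapVars i j f) :
    divDiff i j f = g := by
  have hne : (MvPolynomial.X i - MvPolynomial.X j : MvPolynomial σ K) ≠ 0 :=
    sub_ne_zero.2 fun h => hij (MvPolynomial.X_injective h)
  exact mul_left_cancel₀ hne ((X_sub_X_mul_divDiff i j f).trans h.symm)

theorem divDiff_add {i j : σ} (hij : i ≠ j) (f g : MvPolynomial σ K) :
    divDiff i j (f + g) = divDiff i j f + divDiff i j g := by
  apply divDiff_eq hij
  rw [mul_add, X_sub_X_mul_divDiff, X_sub_X_mul_divDiff]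
  simp only [swapVars, map_add]
  ring

theorem divDiff_C_mul {i j : σ} (hij : i ≠ j) (c : K) (f : MvPolynomial σ K) :
    divDiff i j (MvPolynomial.C c * f) = MvPolynomial.C c * divDiff i j f := by
  apply divDiff_eq hij
  rw [mul_left_comm, X_sub_X_mul_divDiff]
  simp only [swapVars, map_mul, MvPolynomial.rename_C]
  ring

variable [Fintype σ]

theorem dunkl_add (κ : K) (i : σ) (f g : MvPolynomial σ K) :
    dunkl κ i (f + g) = dunkl κ i f + dunkl κ i g := by
  simp only [dunkl, map_add]
  rw [Finset.sum_congr rfl fun j hj => divDiff_add (Finset.ne_of_mem_erase hj).symm f g,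
    Finset.sum_add_distrib]
  ring

theorem dunkl_C_mul (κ : K) (i : σ) (c : K) (f : MvPolynomial σ K) :
    dunkl κ i (MvPolynomial.C c * f) = MvPolynomial.C c * dunkl κ i f := by
  simp only [dunkl]
  rw [Finset.sum_congr rfl fun j hj => divDiff_C_mul (Finset.ne_of_mem_erase hj).symm c f,
    ← Finset.mul_sum]
  simp only [Derivation.leibniz, MvPolynomial.pderiv_C, smul_eq_mul, mul_zero, add_zero]
  ring

theorem dunkl_sum {ι : Type*} (κ : K) (i : σ) (s : Finset ι) (f : ι → MvPolynomial σ K) :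
    dunkl κ i (∑ k ∈ s, f k) = ∑ k ∈ s, dunkl κ i (f k) := by
  classical
  have h0 : dunkl κ i (0 : MvPolynomial σ K) = 0 := by
    simpa using dunkl_C_mul κ i 0 (0 : MvPolynomial σ K)
  exact map_sum (⟨⟨dunkl κ i, h0⟩, dunkl_add κ i⟩ : MvPolynomial σ K →+ MvPolynomial σ K) f s

/-- Only `j = a` and `j = b` give nonzero divided differences, and these cancel the two terms of the
product rule. -/
theorem dunkl_pPoly_of_ne [CharZero K] (κ : K) {a b i : σ} (hab : a ≠ b) (ha : i ≠ a) (hb : i ≠ b)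
    (m l : ℕ) : dunkl κ i (pPoly κ a b m l) = 0 := by
  have hdiv : ∀ j ∈ Finset.univ.erase i, divDiff i j (uPoly κ a m * uPoly κ b l) =
      (if j = a then -(wPoly κ i a m * uPoly κ b l) else 0) +
        (if j = b then -(uPoly κ a m * wPoly κ i b l) else 0) := by
    intro j hj
    have hji : i ≠ j := (Finset.ne_of_mem_erase hj).symm
    apply divDiff_eq hji
    rw [swapVars_mul, swapVars_uPoly, swapVars_uPoly]
    rcases eq_or_ne j a with rfl | hja
    · rw [Equiv.swap_apply_right, Equiv.swap_apply_of_ne_of_ne hb.symm hab.symm]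
      simp only [if_true, if_neg hab]
      linear_combination (uPoly κ b l) * uPoly_sub κ i j m
    · rcases eq_or_ne j b with rfl | hjb
      · rw [Equiv.swap_apply_right, Equiv.swap_apply_of_ne_of_ne ha.symm hab]
        simp only [if_true, if_neg hja]
        linear_combination (uPoly κ a m) * uPoly_sub κ i j l
      · rw [Equiv.swap_apply_of_ne_of_ne ha.symm hja.symm,
          Equiv.swap_apply_of_ne_of_ne hb.symm hjb.symm]
        simp [hja, hjb]
  rw [pPoly_eq, dunkl, Finset.sum_congr rfl hdiv, Finset.sum_add_distrib,
    Finset.sum_ite_eq', Finset.sum_ite_eq',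
    if_pos (Finset.mem_erase.2 ⟨ha.symm, Finset.mem_univ a⟩),
    if_pos (Finset.mem_erase.2 ⟨hb.symm, Finset.mem_univ b⟩), Derivation.leibniz,
    pderiv_uPoly_of_ne κ ha.symm, pderiv_uPoly_of_ne κ hb.symm]
  simp only [smul_eq_mul]
  ring

/-- The derivative and the divided differences assemble into the right side of `euler_uPred`; the
pair `(a, b)`, where both factors change, leaves the cross term. -/
theorem dunkl_pPoly_left [CharZero K] (κ : K) {a b : σ} (hab : a ≠ b) (m l : ℕ) :
    dunkl κ a (pPoly κ a b m l) =
      MvPolynomial.C (m + Fintype.card σ * κ) * (uPred κ a m * uPoly κ b l) +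
        MvPolynomial.C κ * crossTerm κ a b m l := by
  have hdiv : ∀ j ∈ Finset.univ.erase a, divDiff a j (uPoly κ a m * uPoly κ b l) =
      wPoly κ a j m * uPoly κ b l +
        (if j = b then crossTerm κ a b m l - uPoly κ a m * wPoly κ a b l else 0) := by
    intro j hj
    have hja : a ≠ j := (Finset.ne_of_mem_erase hj).symm
    apply divDiff_eq hja
    rw [swapVars_mul, swapVars_uPoly, swapVars_uPoly, Equiv.swap_apply_left]
    rcases eq_or_ne j b with rfl | hjb
    · rw [Equiv.swap_apply_right]
      simp only [if_true, crossTerm]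
      have h1 := uPoly_sub κ a j m
      have h2 := uPoly_sub κ a j l
      linear_combination (-uPoly κ j l -
        (MvPolynomial.X a - MvPolynomial.X j) * wPoly κ a j l) * h1 + uPoly κ j m * h2
    · rw [Equiv.swap_apply_of_ne_of_ne hab.symm hjb.symm]
      simp only [if_neg hjb]
      linear_combination (-uPoly κ b l) * uPoly_sub κ a j m
  have he := euler_uPred κ a m
  rw [← Finset.add_sum_erase _ _ (Finset.mem_univ a)] at he
  rw [pPoly_eq, dunkl, Finset.sum_congr rfl hdiv, Finset.sum_add_distrib,
    Finset.sum_ite_eq', if_pos (Finset.mem_erase.2 ⟨hab.symm, Finset.mem_univ b⟩),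
    ← Finset.sum_mul, Derivation.leibniz, pderiv_uPoly_self, pderiv_uPoly_of_ne κ hab.symm]
  simp only [smul_eq_mul, map_add, map_one] at he ⊢
  linear_combination (-uPoly κ b l) * he

end Dunkl

/-! ### The polynomial ω at equal indices. -/

section Omega

open Finset.HasAntidiagonal (antidiagonal mem_antidiagonal)

variable {σ K : Type*} [Field K]

section Specialize

variable [DecidableEq σ]

/-- The specialization `x_c = X`, `x_d = 1`, all other variables being `0`. -/
noncomputable def specialize (K : Type*) [Field K] (c d : σ) :
    MvPolynomial σ K →ₐ[K] Polynomial K :=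
  MvPolynomial.aeval fun i => if i = c then Polynomial.X else if i = d then 1 else 0

theorem map_specialize_oneSubPow (a : K) (c d i : σ) :
    PowerSeries.map (specialize K c d).toRingHom (oneSubPow a i) = PowerSeries.mk fun k =>
      Polynomial.C (binCoeff a k) *
        (if i = c then Polynomial.X else if i = d then 1 else 0) ^ k := by
  ext1 k
  simp [coeff_oneSubPow, specialize, Polynomial.algebraMap_eq]

theorem map_specialize_oneSubPow_of_ne (a : K) {c d i : σ} (hc : i ≠ c) (hd : i ≠ d) :
    PowerSeries.map (specialize K c d).toRingHom (oneSubPow a i) = 1 := by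
  rw [map_specialize_oneSubPow]
  ext1 k
  cases k with
  | zero => simp [binCoeff_zero, hc, hd]
  | succ k => simp [hc, hd, PowerSeries.coeff_one]

end Specialize

variable [Fintype σ]

theorem poch_one (k : ℕ) : poch (1 : K) k = k.factorial := by
  induction k with
  | zero => simp [poch_zero]
  | succ k ih =>
    rw [poch_succ, ih, Nat.factorial_succ]
    push_cast
    ring

theorem omegaOfGe_self [CharZero K] (κ : K) (a b : σ) (n : ℕ) :
    omegaOfGe κ a b n n = pPoly κ a b n n + ∑ j ∈ Finset.range n,
      MvPolynomial.C (weight κ (j + 1 : ℕ)) *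
        (pPoly κ a b (n + (j + 1)) (n - (j + 1)) +
          pPoly κ a b (n - (j + 1)) (n + (j + 1))) := by
  rw [omegaOfGe, Finset.range_eq_Ico,
    Finset.sum_Ico_add' (fun j => MvPolynomial.C (weight κ (j : ℕ)) *
      (pPoly κ a b (n + j) (n - j) + pPoly κ a b (n - j) (n + j))) 0 n 1]
  congr 1
  refine Finset.sum_congr (by ext; simp [Nat.succ_le_iff]) fun j hj => ?_
  obtain ⟨j, rfl⟩ : ∃ i, j = i + 1 := ⟨j - 1, by have := (Finset.mem_Icc.1 hj).1; omega⟩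
  have e1 : (n : K) - n + 1 = 1 := by ring
  have e2 : κ + n - n + 1 = κ + 1 := by ring
  have e3 : (n : K) - n + (j + 1 : ℕ) = (j + 1 : ℕ) := by ring
  rw [e1, e2, e3, ← mul_add, ← mul_assoc, ← map_mul, Nat.add_sub_cancel, poch_one, weight,
    Int.natAbs_natCast, Nat.factorial_succ]
  congr 2
  have h1 : (j : K) + 1 ≠ 0 := Nat.cast_add_one_ne_zero j
  have h2 : (j.factorial : K) ≠ 0 := Nat.cast_ne_zero.2 j.factorial_ne_zero
  push_cast
  -- With a zero denominator both sides are `0`, so no condition on `κ` is needed.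
  by_cases h : poch (κ + 1) (j + 1) = 0
  · simp [h]
  · field_simp

theorem omegaOfGe_self_comm [CharZero K] (κ : K) (a b : σ) (n : ℕ) :
    omegaOfGe κ a b n n = omegaOfGe κ b a n n := by
  have h (m l : ℕ) : pPoly κ a b m l = pPoly κ b a l m := by
    rw [pPoly_eq, pPoly_eq, mul_comm]
  rw [omegaOfGe_self, omegaOfGe_self, h n n]
  refine congrArg₂ (· + ·) rfl (Finset.sum_congr rfl fun j _ => ?_)
  rw [h, h, add_comm (pPoly κ b a _ _)]

theorem sum_range_two_mul_add_one {M : Type*} [AddCommMonoid M] (n : ℕ) (g : ℕ → M) :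
    ∑ m ∈ Finset.range (2 * n + 1), g m =
      g n + ∑ j ∈ Finset.range n, (g (n + (j + 1)) + g (n - (j + 1))) := by
  have e : 2 * n + 1 = n + (n + 1) := by ring
  rw [e, Finset.sum_range_add, Finset.sum_range_succ', ← Finset.sum_range_reflect g n,
    Finset.sum_add_distrib, add_zero]
  have h : ∀ j ∈ Finset.range n, g (n - 1 - j) = g (n - (j + 1)) := fun j _ => by
    congr 1
    omega
  rw [Finset.sum_congr rfl h]
  abel

theorem omegaOfGe_self_eq_sum [CharZero K] (κ : K) (a b : σ) (n : ℕ) :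
    omegaOfGe κ a b n n = ∑ m ∈ Finset.range (2 * n + 1),
      MvPolynomial.C (weight κ (m - n)) * pPoly κ a b m (2 * n - m) := by
  rw [sum_range_two_mul_add_one, omegaOfGe_self, sub_self, weight_zero, map_one, one_mul]
  refine congrArg₂ (· + ·) (by congr 1; omega) (Finset.sum_congr rfl fun j hj => ?_)
  have hj := Finset.mem_range.1 hj
  have e1 : ((n + (j + 1) : ℕ) : ℤ) - n = (j + 1 : ℕ) := by push_cast; ring
  have e2 : ((n - (j + 1) : ℕ) : ℤ) - n = -(j + 1 : ℕ) := by omega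
  have e3 : 2 * n - (n + (j + 1)) = n - (j + 1) := by omega
  have e4 : 2 * n - (n - (j + 1)) = n + (j + 1) := by omega
  rw [e1, e2, e3, e4, weight_neg, mul_add]

/-! ### Annihilation by the Dunkl operators. -/

section Singular

variable [DecidableEq σ]

theorem dunkl_omegaOfGe_self (κ : K) [CharZero K] (a b i : σ) (n : ℕ) :
    dunkl κ i (omegaOfGe κ a b n n) = dunkl κ i (pPoly κ a b n n) + ∑ j ∈ Finset.range n,
      MvPolynomial.C (weight κ (j + 1 : ℕ)) *
        (dunkl κ i (pPoly κ a b (n + (j + 1)) (n - (j + 1))) +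
          dunkl κ i (pPoly κ a b (n - (j + 1)) (n + (j + 1)))) := by
  simp only [omegaOfGe_self, dunkl_add, dunkl_sum, dunkl_C_mul]

/-- In passing from `k` to `k + 1`, `(κ - k) w(k) = -(κ + 1 + k) w(k + 1)` gives all terms one
weight; the exchange identity then moves the cross term one step outwards. -/
theorem dunkl_partial_sum [CharZero K] {κ : K} (hκ : ∀ i : ℕ, κ + 1 + i ≠ 0) {a b : σ}
    (hab : a ≠ b) {n : ℕ} (hcard : Fintype.card σ * κ = κ - n) (k : ℕ) (hk : k ≤ n) :
    dunkl κ a (pPoly κ a b n n) + ∑ j ∈ Finset.range k,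
      MvPolynomial.C (weight κ (j + 1 : ℕ)) *
        (dunkl κ a (pPoly κ a b (n + (j + 1)) (n - (j + 1))) +
          dunkl κ a (pPoly κ a b (n - (j + 1)) (n + (j + 1)))) =
      MvPolynomial.C ((κ - k) * weight κ k) *
        (uPred κ a (n - k) * uPoly κ b (n + k) + crossTerm κ a b (n + k) (n - k)) := by
  induction k with
  | zero =>
    rw [Finset.sum_range_zero, add_zero, dunkl_pPoly_left κ hab, hcard]
    simp [weight_zero]
    ring
  | succ k ih =>
    rw [Finset.sum_range_succ, ← add_assoc, ih (by omega), dunkl_pPoly_left κ hab,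
      dunkl_pPoly_left κ hab, hcard]
    obtain ⟨r, rfl⟩ : ∃ r, n = k + 1 + r := ⟨n - (k + 1), by omega⟩
    have hsub := pPoly_sub_pPoly κ a b (k + 1 + r + k) r
    have hw := congrArg (MvPolynomial.C (σ := σ)) (weight_natCast_succ hκ k)
    have e1 : k + 1 + r - k = r + 1 := by omega
    have e2 : k + 1 + r - (k + 1) = r := by omega
    have e3 : k + 1 + r + (k + 1) = k + 1 + r + k + 1 := by omega
    have hc : crossTerm κ a b r (k + 1 + r + k + 1) = crossTerm κ a b (k + 1 + r + k + 1) r := by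
      simp only [crossTerm, mul_comm (wPoly κ a b r)]
    rw [e1, e2, e3, uPred_succ, uPred_succ, hc]
    rw [pPoly_eq, pPoly_eq] at hsub
    simp only [map_add, map_sub, map_mul, map_one, map_natCast] at hw ⊢
    push_cast at hw ⊢
    linear_combination (uPoly κ a r * uPoly κ b (k + 1 + r + k) +
      crossTerm κ a b (k + 1 + r + k) (r + 1)) * hw +
        (MvPolynomial.C κ + 1 + k) * MvPolynomial.C (weight κ (k + 1)) * hsub

theorem dunkl_omegaOfGe_self_left [CharZero K] {κ : K} (hκ : ∀ i : ℕ, κ + 1 + i ≠ 0) {a b : σ}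
    (hab : a ≠ b) {n : ℕ} (hcard : Fintype.card σ * κ = κ - n) :
    dunkl κ a (omegaOfGe κ a b n n) = 0 := by
  rw [dunkl_omegaOfGe_self, dunkl_partial_sum hκ hab hcard n le_rfl, Nat.sub_self, uPred_zero,
    crossTerm, wPoly_zero]
  simp

theorem dunkl_omegaOfGe_self_eq_zero [CharZero K] {κ : K} (hκ : ∀ i : ℕ, κ + 1 + i ≠ 0) {a b : σ}
    (hab : a ≠ b) {n : ℕ} (hcard : Fintype.card σ * κ = κ - n) (i : σ) :
    dunkl κ i (omegaOfGe κ a b n n) = 0 := by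
  rcases eq_or_ne i a with rfl | ha
  · exact dunkl_omegaOfGe_self_left hκ hab hcard
  rcases eq_or_ne i b with rfl | hb
  · rw [omegaOfGe_self_comm]
    exact dunkl_omegaOfGe_self_left hκ hab.symm hcard
  rw [dunkl_omegaOfGe_self]
  simp [dunkl_pPoly_of_ne κ hab ha hb]

end Singular

/-! ### Nonvanishing by specialization. -/

section NonZero

variable [DecidableEq σ]

theorem coeff_specialize_uPoly (κ : K) {a c d : σ} (hac : a ≠ c) (had : a ≠ d) (hcd : c ≠ d)
    (m p : ℕ) : (specialize K c d (uPoly κ a m)).coeff p =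
      if p ≤ m then binCoeff κ p * binCoeff κ (m - p) else 0 := by
  have h : specialize K c d (uPoly κ a m) = (specialize K c d).toRingHom (uPoly κ a m) := rfl
  rw [h, uPoly, ← PowerSeries.coeff_map, map_mul, map_specialize_oneSubPow_of_ne 1 hac had,
    one_mul, symSeries, map_prod,
    Finset.prod_eq_mul c d hcd (fun i _ hi => map_specialize_oneSubPow_of_ne κ hi.1 hi.2)
      (fun h => absurd (Finset.mem_univ c) h) (fun h => absurd (Finset.mem_univ d) h),
    map_specialize_oneSubPow, map_specialize_oneSubPow, PowerSeries.coeff_mul,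
    Polynomial.finsetSum_coeff, Finset.Nat.sum_antidiagonal_eq_sum_range_succ_mk]
  simp only [PowerSeries.coeff_mk, if_true, if_neg hcd.symm, one_pow, mul_one,
    Polynomial.coeff_mul_C, Polynomial.coeff_C_mul, Polynomial.coeff_X_pow]
  simp

theorem coeff_specialize_omegaOfGe_self [CharZero K] (κ : K) {a b c d : σ} (hac : a ≠ c)
    (had : a ≠ d) (hbc : b ≠ c) (hbd : b ≠ d) (hcd : c ≠ d) (n : ℕ) :
    (specialize K c d (omegaOfGe κ a b n n)).coeff n =
      ∑ x ∈ antidiagonal n, binCoeff κ x.1 * binCoeff κ x.2 * shiftSum κ n (-(x.1 : ℤ)) := by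
  have hC (z : K) : specialize K c d (MvPolynomial.C z) = Polynomial.C z := by
    simp [specialize, Polynomial.algebraMap_eq]
  rw [omegaOfGe_self_eq_sum, map_sum, Polynomial.finsetSum_coeff]
  simp only [map_mul, hC, pPoly_eq, Polynomial.coeff_C_mul]
  simp only [Polynomial.coeff_mul,
    coeff_specialize_uPoly κ hac had hcd, coeff_specialize_uPoly κ hbc hbd hcd, Finset.mul_sum]
  rw [Finset.sum_comm, ← Finset.Nat.sum_antidiagonal_swap]
  refine Finset.sum_congr rfl fun x hx => ?_
  have hx := mem_antidiagonal.1 hx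
  obtain ⟨q, p⟩ := x
  simp only [Prod.fst_swap, Prod.snd_swap] at hx ⊢
  have h1 : ∀ m ∈ Finset.range (2 * n + 1), weight κ (m - n) *
      ((if p ≤ m then binCoeff κ p * binCoeff κ (m - p) else 0) *
        (if q ≤ 2 * n - m then binCoeff κ q * binCoeff κ (2 * n - m - q) else 0)) =
      if p ≤ m ∧ q ≤ 2 * n - m then binCoeff κ q * binCoeff κ p *
        (binCoeff κ (m - p) * binCoeff κ (2 * n - m - q) * weight κ (m - n)) else 0 := by
    intro m _
    by_cases hp : p ≤ m <;> by_cases hq : q ≤ 2 * n - m <;> simp [hp, hq]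
    ring
  -- Since `p + q = n`, the admissible `m` are `p + k` with `0 ≤ k ≤ n`, and `m - n = k - q`: this
  -- is `shiftSum` at shift `-q`.
  have h2 : (Finset.range (2 * n + 1)).filter (fun m => p ≤ m ∧ q ≤ 2 * n - m) =
      Finset.Ico p (p + n + 1) := by
    ext m
    simp only [Finset.mem_filter, Finset.mem_range, Finset.mem_Ico]
    omega
  rw [Finset.sum_congr rfl h1, ← Finset.sum_filter, h2, Finset.sum_Ico_eq_sum_range,
    ← Finset.mul_sum, shiftSum, Finset.Nat.sum_antidiagonal_eq_sum_range_succ_mk]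
  congr 1
  refine Finset.sum_congr (congrArg _ (by omega)) fun k hk => ?_
  have hk := Finset.mem_range.1 hk
  have e1 : p + k - p = k := by omega
  have e2 : 2 * n - (p + k) - q = n - k := by omega
  have e3 : ((p + k : ℕ) : ℤ) - n = -(q : ℤ) + k := by omega
  rw [e1, e2, e3]

theorem omegaOfGe_self_ne_zero [CharZero K] {κ : K} (hκ : ∀ z : ℤ, 2 * κ + z ≠ 0)
    {a b c d : σ} (hac : a ≠ c) (had : a ≠ d) (hbc : b ≠ c) (hbd : b ≠ d) (hcd : c ≠ d) {n : ℕ}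
    (hn : 1 ≤ n) : omegaOfGe κ a b n n ≠ 0 := by
  intro h
  apply sum_binCoeff_mul_shiftSum_ne_zero hκ hn
  rw [← coeff_specialize_omegaOfGe_self κ hac had hbc hbd hcd n, h]
  simp

end NonZero

end Omega

/-- If `M` divides `2n`, it divides `gcd(2M, 2n) = 2 gcd(M, n)`, which is positive and too small.
For `M = N - 1` this says that `2κ` is not an integer. -/
theorem not_dvd_two_mul_of_gcd_lt {M n : ℕ} (h : 2 * Nat.gcd M n < M) : ¬ M ∣ 2 * n := by
  intro hd
  have h1 : M ∣ 2 * Nat.gcd M n := by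
    rw [← Nat.gcd_mul_left]
    exact Nat.dvd_gcd (Dvd.intro_left 2 rfl) hd
  have hM : 0 < M := by omega
  exact absurd (Nat.le_of_dvd (mul_pos two_pos (Nat.gcd_pos_of_pos_left n hM)) h1) (by omega)

end SymDunkl

theorem mainTheorem9 {K : Type*} [Field K] [CharZero K] (N n : ℕ) (hN : 4 ≤ N) (hn : 1 ≤ n)
    (hgcd : (Nat.gcd (N - 1) n : ℚ) < ((N : ℚ) - 1) / 2) :
    SymDunkl.IsSingular (-(n : K) / ((N : K) - 1))
      (SymDunkl.omega (-(n : K) / ((N : K) - 1))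
        (⟨0, by omega⟩ : Fin N) (⟨1, by omega⟩ : Fin N) n n) := by
  obtain ⟨M, rfl⟩ : ∃ M, N = M + 1 := ⟨N - 1, by omega⟩
  have hM : (M : K) ≠ 0 := Nat.cast_ne_zero.2 (by omega)
  have hκ : -(n : K) / (((M + 1 : ℕ) : K) - 1) = -n / M := by push_cast; simp
  rw [hκ, SymDunkl.omega, if_pos le_rfl]
  have hlt : 2 * Nat.gcd M n < M := by
    rw [Nat.add_sub_cancel] at hgcd
    push_cast at hgcd
    have : (2 : ℚ) * (Nat.gcd M n : ℚ) < M := by linarith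
    exact_mod_cast this
  have hdvd := SymDunkl.not_dvd_two_mul_of_gcd_lt hlt
  have h2 : ∀ z : ℤ, 2 * (-(n : K) / M) + z ≠ 0 := fun z hz => by
    field_simp at hz
    have hz' : (M : ℤ) * z = 2 * n := by
      have : ((M : K) * z) = 2 * n := by linear_combination hz
      exact_mod_cast this
    exact hdvd (Int.natCast_dvd_natCast.1 ⟨z, by push_cast; exact hz'.symm⟩)
  have h1 : ∀ i : ℕ, -(n : K) / M + 1 + i ≠ 0 := fun i hi => h2 (2 * (1 + i)) (by
    push_cast
    linear_combination 2 * hi)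
  have hne : ∀ {i j : ℕ} (hi : i < M + 1) (hj : j < M + 1), i ≠ j →
      (⟨i, hi⟩ : Fin (M + 1)) ≠ ⟨j, hj⟩ := fun _ _ h e => h (Fin.ext_iff.1 e)
  have l2 : 2 < M + 1 := by omega
  have l3 : 3 < M + 1 := by omega
  -- `N ≥ 4` supplies the two variables, besides `x_a` and `x_b`, needed for the specialization.
  refine ⟨SymDunkl.omegaOfGe_self_ne_zero h2 (c := ⟨2, l2⟩) (d := ⟨3, l3⟩)
    (hne _ _ (by decide)) (hne _ _ (by decide)) (hne _ _ (by decide)) (hne _ _ (by decide))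
    (hne _ _ (by decide)) hn,
    SymDunkl.dunkl_omegaOfGe_self_eq_zero h1 (hne _ _ (by decide)) ?_⟩
  rw [Fintype.card_fin]
  push_cast
  field_simp
  ring
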